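/- **Setting.** Let $N\ge 1$ and $n\ge 0$. Let $E=\mathbb R^N\times\mathbb R\to\mathbb R^N$ be the trivial line bundle, with coordinates $(x^i,u_J)$ on the infinite jet bundle $J^\infty E$, where $1\le i\le N$ and $J=(j_1,\dots,j_N)$ runs over all multi-indices, of order $|J|=j_1+\cdots+j_N$. Let $\mathrm{Loc}(E)$ be the space of local functions, i.e. pullbacks to $J^\infty E$ of smooth real functions on some finite jet bundle $J^kE$. Put $$\frac{d}{dx^i}=\frac{\partial}{\partial x^i}+\sum_J u_{iJ}\frac{\partial}{\partial u_J},$$ where $iJ$ is $J$ with its $i$-th entry increased by one. Let $\Omega^{k,0}(J^\infty E)$ be the space of forms $\sum_{i_1<\cdots<i_k} f_{i_1\dots i_k}\,dx^{i_1}\wedge\cdots\wedge dx^{i_k}$ with $f_{i_1\dots i_k}\in\mathrm{Loc}(E)$, and $d_H\omega=\sum_i dx^i\wedge\frac{d}{dx^i}\omega$ the horizontal differential. An $n$-multilinear local differential operator is an $n$-linear map $A:\mathrm{Loc}(E)^{\otimes n}\to\mathrm{Loc}(E)$ of the form $$A(f_1,\dots,f_n)=\sum p_{I_1,\dots,I_n,\alpha_1,\dots,\alpha_n}\prod_{j=1}^n\Big(\frac{d}{d\mathbf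 x}\Big)^{I_j}\Big(\frac{\partial}{\partial\mathbf u}\Big)^{\alpha_j}f_j,$$ where the coefficients $p_{I_1,\dots,\alpha_n}$ are local functions, the $I_j$ are multi-indices, the $\alpha_j$ are finitely supported $\mathbb Z_{\ge0}$-valued functions on the set of multi-indices, $\big(\frac{d}{d\mathbf x}\big)^{I}=\prod_i\big(\frac{d}{dx^i}\big)^{I_i}$ and $\big(\frac{\partial}{\partial\mathbf u}\big)^{\alpha}=\prod_J\big(\frac{\partial}{\partial u_J}\big)^{\alpha(J)}$, such that for every $m$ only finitely many coefficients with $\sum_j\deg_f(\alpha_j)\le m$ are nonzero. Here $\deg_f(\alpha)$ is the maximal $|J|$ with $\alpha(J)\ne0$ (and $0$ if $\alpha=0$). These operators form the vector space $\mathrm{LDO}(n)$. The operator complex $O^*(n)$ consists, in degree $k$, of the forms $\sum_{i_1<\cdots<i_k}A_{i_1\dots i_k}\,dx^{i_1}\wedge\cdots\wedge dx^{i_k}$ with coefficients in $\mathrm{LDO}(n)$; its differential is $$d\big(A\,dx^{i_1}\wedge\cdots\wedge dx^{i_k}\big)=\sum_{i=1}^N\Big(\frac{d}{dx^i}\circ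 A\Big)\,dx^i\wedge dx^{i_1}\wedge\cdots\wedge dx^{i_k}.$$ For $A\in O^N(n)$, $A=a\,dx^1\wedge\cdots\wedge dx^N$ with $a\in\mathrm{LDO}(n)$, and $f_1,\dots,f_n\in\mathrm{Loc}(E)$, write $A(f_1,\dots,f_n)=a(f_1,\dots,f_n)\,dx^1\wedge\cdots\wedge dx^N\in\Omega^{N,0}(J^\infty E)$. **Corollary 6.6 ("pointwise = global").** Let $A\in O^N(n)$. Then $A(f_1,\dots,f_n)\in d_H\,\Omega^{N-1,0}(J^\infty E)$ for all $f_1,\dots,f_n\in\mathrm{Loc}(E)$ if and only if $A$ is a boundary in $O^*(n)$, i.e. $A=dB$ for some $B\in O^{N-1}(n)$. -/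

import Mathlib

noncomputable section

namespace JetCalculus

open scoped ContDiff

/-! ### Jets of the trivial line bundle over `ℝ^N` and local functions -/

/-- Multi-indices `J = (j₁, …, j_N)`. -/
abbrev MultiIndex (N : ℕ) := Fin N → ℕ

/-- The order `|J| = j₁ + ⋯ + j_N`. -/
def order {N : ℕ} (J : MultiIndex N) : ℕ := ∑ i, J i

/-- The multi-index `iJ`, i.e. `J` with its `i`-th entry raised by one. -/
def raise {N : ℕ} (i : Fin N) (J : MultiIndex N) : MultiIndex N := J + Pi.single i 1

/-- The finitely many multi-indices of order at most `k`. -/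
def multiIndicesLE (N k : ℕ) : Finset (MultiIndex N) :=
  (Fintype.piFinset fun _ => Finset.range (k + 1)).filter fun J => order J ≤ k

/-- Points `(x, u)` of the infinite jet bundle `J^∞ E` of `E = ℝ^N × ℝ → ℝ^N`:
`x = (x^i)` and `u = (u_J)`, where `J` runs over all multi-indices. -/
abbrev InfJet (N : ℕ) := (Fin N → ℝ) × (MultiIndex N → ℝ)

/-- Points of the finite jet bundle `J^k E` (a finite dimensional space). -/
abbrev FinJet (N k : ℕ) := (Fin N → ℝ) × (multiIndicesLE N k → ℝ)

/-- The projection `J^∞ E → J^k E`. -/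
def jetProj (N k : ℕ) : InfJet N →ₗ[ℝ] FinJet N k :=
  LinearMap.prodMap LinearMap.id (LinearMap.funLeft ℝ ℝ Subtype.val)

/-- `f` is the pullback to `J^∞ E` of a smooth function on `J^k E`. -/
def IsLocalOfOrder {N : ℕ} (k : ℕ) (f : InfJet N → ℝ) : Prop :=
  ∃ g : FinJet N k → ℝ, ContDiff ℝ ∞ g ∧ f = g ∘ jetProj N k

theorem mem_multiIndicesLE {N k : ℕ} {J : MultiIndex N} :
    J ∈ multiIndicesLE N k ↔ order J ≤ k := by
  unfold multiIndicesLE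
  simp only [Finset.mem_filter, Fintype.mem_piFinset, Finset.mem_range, and_iff_right_iff_imp]
  intro h i
  exact Nat.lt_succ_of_le ((Finset.single_le_sum (f := J) (fun _ _ => Nat.zero_le _)
    (Finset.mem_univ i)).trans h)

theorem IsLocalOfOrder.mono {N k l : ℕ} (hkl : k ≤ l) {f : InfJet N → ℝ}
    (hf : IsLocalOfOrder k f) : IsLocalOfOrder l f := by
  obtain ⟨g, hg, rfl⟩ := hf
  refine ⟨fun q => g (q.1, fun J => q.2 ⟨J.1, mem_multiIndicesLE.2
    ((mem_multiIndicesLE.1 J.2).trans hkl)⟩), ?_, rfl⟩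
  exact hg.comp (contDiff_fst.prodMk (contDiff_pi.2 fun J =>
    (contDiff_apply ℝ ℝ _).comp contDiff_snd))

/-- The algebra `Loc(E)` of local functions: pullbacks to `J^∞ E` of smooth functions on some
finite jet bundle `J^k E`. -/
def Loc (N : ℕ) : Subalgebra ℝ (InfJet N → ℝ) where
  carrier := {f | ∃ k, IsLocalOfOrder k f}
  add_mem' := by
    rintro f g ⟨k, hf⟩ ⟨l, hg⟩
    obtain ⟨f', hf', rfl⟩ := hf.mono (le_max_left k l)
    obtain ⟨g', hg', rfl⟩ := hg.mono (le_max_right k l)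
    exact ⟨_, _, hf'.add hg', rfl⟩
  mul_mem' := by
    rintro f g ⟨k, hf⟩ ⟨l, hg⟩
    obtain ⟨f', hf', rfl⟩ := hf.mono (le_max_left k l)
    obtain ⟨g', hg', rfl⟩ := hg.mono (le_max_right k l)
    exact ⟨_, _, hf'.mul hg', rfl⟩
  algebraMap_mem' c := ⟨0, fun _ => c, contDiff_const, rfl⟩

/-! ### Partial and total derivatives -/

/-- The direction of the coordinate `x^i`. -/
def baseDir {N : ℕ} (i : Fin N) : InfJet N := (Pi.single i 1, 0)

/-- The direction of the coordinate `u_J`. -/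
def fibreDir {N : ℕ} (J : MultiIndex N) : InfJet N := (0, Pi.single J 1)

theorem lineDeriv_comp_jetProj {N k : ℕ} {g : FinJet N k → ℝ} (hg : ContDiff ℝ ∞ g)
    (p v : InfJet N) :
    lineDeriv ℝ (g ∘ jetProj N k) p v = fderiv ℝ g (jetProj N k p) (jetProj N k v) := by
  rw [← ((hg.differentiable (by simp)) _).lineDeriv_eq_fderiv]
  simp [lineDeriv]

theorem isLocalOfOrder_lineDeriv {N k : ℕ} {f : InfJet N → ℝ} (hf : IsLocalOfOrder k f)
    (v : InfJet N) : IsLocalOfOrder k fun p => lineDeriv ℝ f p v := by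
  obtain ⟨g, hg, rfl⟩ := hf
  refine ⟨fun q => fderiv ℝ g q (jetProj N k v), ?_, ?_⟩
  · exact (hg.fderiv_right (m := ∞) (by simp)).clm_apply contDiff_const
  · funext p
    exact lineDeriv_comp_jetProj hg p v

/-- The derivative of local functions in a fixed direction of `J^∞ E`. -/
def dirDeriv {N : ℕ} (v : InfJet N) : Loc N →ₗ[ℝ] Loc N where
  toFun f := ⟨fun p => lineDeriv ℝ f.1 p v,
    let ⟨k, hk⟩ := f.2
    ⟨k, isLocalOfOrder_lineDeriv hk v⟩⟩
  map_add' := by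
    rintro ⟨f, k, hf⟩ ⟨g, l, hg⟩
    obtain ⟨f', hf', rfl⟩ := hf.mono (le_max_left k l)
    obtain ⟨g', hg', rfl⟩ := hg.mono (le_max_right k l)
    ext p
    change lineDeriv ℝ ((f' + g') ∘ jetProj N _) p v = lineDeriv ℝ (f' ∘ jetProj N _) p v +
      lineDeriv ℝ (g' ∘ jetProj N _) p v
    rw [lineDeriv_comp_jetProj (g := f' + g') (hf'.add hg'), lineDeriv_comp_jetProj hf',
      lineDeriv_comp_jetProj hg', fderiv_add (hf'.differentiable (by simp) _)
        (hg'.differentiable (by simp) _)]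
    rfl
  map_smul' := by
    rintro c ⟨f, k, f', hf', rfl⟩
    ext p
    change lineDeriv ℝ ((c • f') ∘ jetProj N _) p v = c * lineDeriv ℝ (f' ∘ jetProj N _) p v
    rw [lineDeriv_comp_jetProj (g := c • f') (hf'.const_smul c), lineDeriv_comp_jetProj hf',
      fderiv_const_smul (hf'.differentiable (by simp) _)]
    rfl

/-- `∂/∂x^i` on local functions. -/
def baseDeriv {N : ℕ} (i : Fin N) : Loc N →ₗ[ℝ] Loc N := dirDeriv (baseDir i)

/-- `∂/∂u_J` on local functions. -/
def fibreDeriv {N : ℕ} (J : MultiIndex N) : Loc N →ₗ[ℝ] Loc N := dirDeriv (fibreDir J)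

/-- The coordinate function `u_J`. -/
def coordU {N : ℕ} (J : MultiIndex N) : Loc N :=
  ⟨fun p => p.2 J, order J, fun q => q.2 ⟨J, mem_multiIndicesLE.2 le_rfl⟩,
    (contDiff_apply ℝ ℝ _).comp contDiff_snd, rfl⟩

theorem dirDeriv_mul {N : ℕ} (v : InfJet N) (f g : Loc N) :
    dirDeriv v (f * g) = dirDeriv v f * g + f * dirDeriv v g := by
  obtain ⟨f, k, hf⟩ := f
  obtain ⟨g, l, hg⟩ := g
  obtain ⟨f', hf', rfl⟩ := hf.mono (le_max_left k l)
  obtain ⟨g', hg', rfl⟩ := hg.mono (le_max_right k l)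
  ext p
  change lineDeriv ℝ ((f' * g') ∘ jetProj N _) p v = lineDeriv ℝ (f' ∘ jetProj N _) p v *
    g' (jetProj N _ p) + f' (jetProj N _ p) * lineDeriv ℝ (g' ∘ jetProj N _) p v
  rw [lineDeriv_comp_jetProj (g := f' * g') (hf'.mul hg'), lineDeriv_comp_jetProj hf',
    lineDeriv_comp_jetProj hg', fderiv_mul (hf'.differentiable (by simp) _)
      (hg'.differentiable (by simp) _)]
  simp
  ring

theorem dirDeriv_comm {N : ℕ} (v w : InfJet N) (f : Loc N) :
    dirDeriv v (dirDeriv w f) = dirDeriv w (dirDeriv v f) := by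
  obtain ⟨f, k, f', hf', rfl⟩ := f
  have key : ∀ v w : InfJet N, ∀ p, lineDeriv ℝ
      (fun p => lineDeriv ℝ (f' ∘ jetProj N k) p w) p v =
      fderiv ℝ (fderiv ℝ f') (jetProj N k p) (jetProj N k v) (jetProj N k w) := by
    intro v w p
    have h2 : ContDiff ℝ ∞ (fderiv ℝ f') := hf'.fderiv_right (m := ∞) (by simp)
    have h1 : (fun p => lineDeriv ℝ (f' ∘ jetProj N k) p w) =
        (fun q => fderiv ℝ f' q (jetProj N k w)) ∘ jetProj N k := by
      funext p
      exact lineDeriv_comp_jetProj hf' p w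
    rw [h1, lineDeriv_comp_jetProj (h2.clm_apply contDiff_const),
      fderiv_clm_apply (h2.differentiable (by simp) _) (differentiableAt_const _)]
    simp
  ext p
  change lineDeriv ℝ (fun p => lineDeriv ℝ (f' ∘ jetProj N k) p w) p v =
    lineDeriv ℝ (fun p => lineDeriv ℝ (f' ∘ jetProj N k) p v) p w
  rw [key, key]
  exact ((hf'.of_le (m := 2) (by norm_cast)).contDiffAt.isSymmSndFDerivAt (by simp)) _ _

theorem fibreDeriv_eq_zero {N k : ℕ} {f : Loc N} (hf : IsLocalOfOrder k f.1)
    {J : MultiIndex N} (hJ : k < order J) : fibreDeriv J f = 0 := by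
  obtain ⟨f, h⟩ := f
  obtain ⟨g, hg, rfl⟩ := hf
  ext p
  change lineDeriv ℝ (g ∘ jetProj N k) p (fibreDir J) = 0
  rw [lineDeriv_comp_jetProj hg]
  have : jetProj N k (fibreDir J) = 0 := by
    refine Prod.ext rfl (funext fun L => ?_)
    have : L.1 ≠ J := by
      rintro rfl
      exact absurd (mem_multiIndicesLE.1 L.2) (by omega)
    simp [jetProj, fibreDir, LinearMap.funLeft, this]
  rw [this, map_zero]

theorem exists_order {N : ℕ} (f : Loc N) : ∃ k, IsLocalOfOrder k f.1 := f.2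

theorem finite_support_total {N : ℕ} (i : Fin N) (f : Loc N) :
    (Function.support fun J => coordU (raise i J) * fibreDeriv J f).Finite := by
  obtain ⟨k, hk⟩ := exists_order f
  refine (multiIndicesLE N k).finite_toSet.subset fun J hJ => ?_
  by_contra h
  exact hJ (by
    simp only [fibreDeriv_eq_zero hk (not_le.1 fun h' => h (mem_multiIndicesLE.2 h')), mul_zero])

/-- The total derivative `d/dx^i = ∂/∂x^i + ∑_J u_{iJ} ∂/∂u_J`; on every local function the
sum has only finitely many nonzero terms. -/
def totalDeriv {N : ℕ} (i : Fin N) : Loc N →ₗ[ℝ] Loc N where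
  toFun f := baseDeriv i f + ∑ᶠ J, coordU (raise i J) * fibreDeriv J f
  map_add' f g := by
    simp only [map_add, mul_add]
    rw [finsum_add_distrib (finite_support_total i f) (finite_support_total i g)]
    abel
  map_smul' c f := by
    simp only [map_smul, mul_smul_comm, RingHom.id_apply, smul_add]
    rw [smul_finsum' c (finite_support_total i f)]

theorem totalDeriv_eq {N : ℕ} (i : Fin N) (f : Loc N) {k : ℕ} (hk : IsLocalOfOrder k f.1) :
    totalDeriv i f = baseDeriv i f +
      ∑ J ∈ multiIndicesLE N k, coordU (raise i J) * fibreDeriv J f := by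
  change baseDeriv i f + ∑ᶠ J, coordU (raise i J) * fibreDeriv J f = _
  rw [finsum_eq_sum_of_support_subset]
  intro J hJ
  by_contra h
  exact hJ (by
    simp only [fibreDeriv_eq_zero hk (not_le.1 fun h' => h (mem_multiIndicesLE.2 h')), mul_zero])

theorem totalDeriv_mul {N : ℕ} (i : Fin N) (f g : Loc N) :
    totalDeriv i (f * g) = totalDeriv i f * g + f * totalDeriv i g := by
  obtain ⟨k, hf⟩ := exists_order f
  obtain ⟨l, hg⟩ := exists_order g
  obtain ⟨m, hfg⟩ := exists_order (f * g)
  rw [totalDeriv_eq i f (hf.mono (le_max_left k (max l m))),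
    totalDeriv_eq i g (hg.mono ((le_max_left l m).trans (le_max_right k _))),
    totalDeriv_eq i (f * g) (hfg.mono ((le_max_right l m).trans (le_max_right k _)))]
  simp only [baseDeriv, fibreDeriv, dirDeriv_mul, mul_add, add_mul, Finset.sum_add_distrib,
    Finset.sum_mul, Finset.mul_sum]
  have h1 : ∀ J, coordU (raise i J) * (dirDeriv (fibreDir J) f * g) =
      coordU (raise i J) * dirDeriv (fibreDir J) f * g := fun J => by ring
  have h2 : ∀ J, coordU (raise i J) * (f * dirDeriv (fibreDir J) g) =
      f * (coordU (raise i J) * dirDeriv (fibreDir J) g) := fun J => by ring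
  simp only [h1, h2]
  abel

theorem dirDeriv_coordU {N : ℕ} (v : InfJet N) (J : MultiIndex N) :
    dirDeriv v (coordU J) = algebraMap ℝ (Loc N) (v.2 J) := by
  ext p
  change lineDeriv ℝ (fun p : InfJet N => p.2 J) p v = v.2 J
  simp [lineDeriv]

theorem totalDeriv_coordU {N : ℕ} (i : Fin N) (J : MultiIndex N) :
    totalDeriv i (coordU J) = coordU (raise i J) := by
  change baseDeriv i (coordU J) + ∑ᶠ L, coordU (raise i L) * fibreDeriv L (coordU J) = _
  rw [finsum_eq_single _ J]
  · simp [baseDeriv, fibreDeriv, dirDeriv_coordU, baseDir, fibreDir]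
  · intro L hL
    simp [fibreDeriv, dirDeriv_coordU, fibreDir, hL.symm]

theorem totalDeriv_comm {N : ℕ} (i j : Fin N) : Commute (totalDeriv (N := N) i) (totalDeriv j) := by
  refine LinearMap.ext fun f => ?_
  change totalDeriv i (totalDeriv j f) = totalDeriv j (totalDeriv i f)
  obtain ⟨k, hf⟩ := exists_order f
  have hd : ∀ v, IsLocalOfOrder k (dirDeriv v f).1 := fun v => isLocalOfOrder_lineDeriv hf v
  have key : ∀ i j : Fin N, totalDeriv i (totalDeriv j f) =
      baseDeriv i (baseDeriv j f) +
      (∑ J ∈ multiIndicesLE N k, coordU (raise i J) * dirDeriv (fibreDir J) (baseDeriv j f)) +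
      (∑ L ∈ multiIndicesLE N k, coordU (raise i (raise j L)) * fibreDeriv L f) +
      (∑ L ∈ multiIndicesLE N k, coordU (raise j L) * dirDeriv (baseDir i) (fibreDeriv L f)) +
      ∑ L ∈ multiIndicesLE N k, ∑ J ∈ multiIndicesLE N k,
        coordU (raise j L) * coordU (raise i J) * fibreDeriv J (fibreDeriv L f) := by
    intro i j
    rw [totalDeriv_eq j f hf, map_add, map_sum, totalDeriv_eq i (baseDeriv j f) (hd _)]
    have : ∀ L, totalDeriv i (coordU (raise j L) * fibreDeriv L f) =
        coordU (raise i (raise j L)) * fibreDeriv L f +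
        (coordU (raise j L) * dirDeriv (baseDir i) (fibreDeriv L f) +
        ∑ J ∈ multiIndicesLE N k,
          coordU (raise j L) * coordU (raise i J) * fibreDeriv J (fibreDeriv L f)) := by
      intro L
      rw [totalDeriv_mul, totalDeriv_coordU, totalDeriv_eq i (fibreDeriv L f) (hd _), mul_add,
        Finset.mul_sum]
      simp only [mul_assoc]
      rfl
    rw [Finset.sum_congr rfl fun L _ => this L]
    simp only [Finset.sum_add_distrib, fibreDeriv]
    abel
  rw [key i j, key j i]
  have e1 : baseDeriv i (baseDeriv j f) = baseDeriv j (baseDeriv i f) := dirDeriv_comm _ _ _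
  have e2 : ∀ (i : Fin N) J, dirDeriv (fibreDir J) (baseDeriv i f) =
      dirDeriv (baseDir i) (fibreDeriv J f) := fun i J => dirDeriv_comm _ _ _
  have e3 : ∀ L, raise i (raise j L) = raise j (raise i L) := fun L => by
    simp only [raise, add_assoc, add_comm (Pi.single i 1 : MultiIndex N)]
  have e4 : (∑ L ∈ multiIndicesLE N k, ∑ J ∈ multiIndicesLE N k,
        coordU (raise j L) * coordU (raise i J) * fibreDeriv J (fibreDeriv L f)) =
      ∑ L ∈ multiIndicesLE N k, ∑ J ∈ multiIndicesLE N k,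
        coordU (raise i L) * coordU (raise j J) * fibreDeriv J (fibreDeriv L f) := by
    rw [Finset.sum_comm]
    refine Finset.sum_congr rfl fun L _ => Finset.sum_congr rfl fun J _ => ?_
    rw [show fibreDeriv L (fibreDeriv J f) = fibreDeriv J (fibreDeriv L f) from
      dirDeriv_comm _ _ _]
    ring
  rw [e1, e4]
  simp only [e2, e3]
  abel

theorem fibreDeriv_comm {N : ℕ} (J L : MultiIndex N) :
    Commute (fibreDeriv J) (fibreDeriv L) :=
  LinearMap.ext fun f => dirDeriv_comm _ _ f

theorem totalDerivPow_pairwise {N : ℕ} (I : MultiIndex N) (s : Set (Fin N)) :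
    s.Pairwise (Function.onFun Commute
      fun i => (totalDeriv i : Module.End ℝ (Loc N)) ^ I i) :=
  fun i _ j _ _ => (totalDeriv_comm i j).pow_pow _ _

theorem fibreDerivPow_pairwise {N : ℕ} (α : MultiIndex N →₀ ℕ) :
    (α.support : Set (MultiIndex N)).Pairwise (Function.onFun Commute
      fun J => (fibreDeriv J : Module.End ℝ (Loc N)) ^ α J) :=
  fun J _ L _ _ => (fibreDeriv_comm J L).pow_pow _ _

/-- `(d/dx)^I = (d/dx^1)^{i₁} ⋯ (d/dx^N)^{i_N}`. -/
def totalDerivPow {N : ℕ} (I : MultiIndex N) : Module.End ℝ (Loc N) :=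
  Finset.univ.noncommProd (fun i => (totalDeriv i : Module.End ℝ (Loc N)) ^ I i)
    (totalDerivPow_pairwise I _)

/-- `(∂/∂u)^α = ∏_J (∂/∂u_J)^{α(J)}` for a finitely supported exponent `α`. -/
def fibreDerivPow {N : ℕ} (α : MultiIndex N →₀ ℕ) : Module.End ℝ (Loc N) :=
  α.support.noncommProd (fun J => (fibreDeriv J : Module.End ℝ (Loc N)) ^ α J)
    (fibreDerivPow_pairwise α)

/-- The formal differential degree of `α`: the maximal order of a `J` with `α(J) ≠ 0`
(and `0` for `α = 0`). -/
def formalDegree {N : ℕ} (α : MultiIndex N →₀ ℕ) : ℕ := α.support.sup order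

/-! ### Multilinear local differential operators -/

/-- Indices `(I₁, …, I_n, α₁, …, α_n)` of the terms of an `n`-multilinear operator. -/
abbrev TermIndex (N n : ℕ) := (Fin n → MultiIndex N) × (Fin n → MultiIndex N →₀ ℕ)

/-- `((d/dx)^{I₁} (∂/∂u)^{α₁} f₁) ⋯ ((d/dx)^{I_n} (∂/∂u)^{α_n} f_n)`. -/
def termValue {N n : ℕ} (q : TermIndex N n) (f : Fin n → Loc N) : Loc N :=
  ∏ j, totalDerivPow (q.1 j) (fibreDerivPow (q.2 j) (f j))

/-- For each `m` only finitely many coefficients with `∑ deg_f(α_j) ≤ m` are nonzero. -/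
def FiniteInEachDegree {N n : ℕ} (p : TermIndex N n → Loc N) : Prop :=
  ∀ m : ℕ, {q | ∑ j, formalDegree (q.2 j) ≤ m ∧ p q ≠ 0}.Finite

/-- An `n`-linear map on local functions is a local differential operator (LDO) if it has the
form `∑ p_{I,α} ((d/dx)^{I₁}(∂/∂u)^{α₁} f₁) ⋯ ((d/dx)^{I_n}(∂/∂u)^{α_n} f_n)` with local
functions `p_{I,α}` that are finite in each formal degree. -/
def IsLDO {N n : ℕ} (A : MultilinearMap ℝ (fun _ : Fin n => Loc N) (Loc N)) : Prop :=
  ∃ p : TermIndex N n → Loc N, FiniteInEachDegree p ∧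
    ∀ f, A f = ∑ᶠ q, p q * termValue q f

theorem fibreDerivPow_eq_zero {N k : ℕ} {f : Loc N} (hf : IsLocalOfOrder k f.1)
    {α : MultiIndex N →₀ ℕ} (hα : k < formalDegree α) : fibreDerivPow α f = 0 := by
  obtain ⟨J, hJ, hkJ⟩ := Finset.lt_sup_iff.1 hα
  rw [fibreDerivPow, ← Finset.noncommProd_erase_mul _ hJ _ (fibreDerivPow_pairwise α)]
  obtain ⟨a, ha⟩ := Nat.exists_eq_succ_of_ne_zero (Finsupp.mem_support_iff.1 hJ)
  rw [ha, pow_succ]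
  simp [Module.End.mul_apply, fibreDeriv_eq_zero hf hkJ]

theorem finite_support_terms {N n : ℕ} {p : TermIndex N n → Loc N} (hp : FiniteInEachDegree p)
    (f : Fin n → Loc N) : {q | p q ≠ 0 ∧ termValue q f ≠ 0}.Finite := by
  choose k hk using fun j => exists_order (f j)
  refine (hp (∑ j, k j)).subset fun q hq => ⟨Finset.sum_le_sum fun j _ => ?_, hq.1⟩
  by_contra h
  refine hq.2 (Finset.prod_eq_zero (Finset.mem_univ j) ?_)
  rw [fibreDerivPow_eq_zero (hk j) (not_le.1 h), map_zero]

theorem finite_support_mul {N n : ℕ} {p : TermIndex N n → Loc N} (hp : FiniteInEachDegree p)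
    (f : Fin n → Loc N) : (Function.support fun q => p q * termValue q f).Finite :=
  (finite_support_terms hp f).subset fun _ hq => ⟨left_ne_zero_of_mul hq, right_ne_zero_of_mul hq⟩

/-- The real vector space `LDO(n)` of `n`-multilinear local differential operators. -/
def LDO (N n : ℕ) : Submodule ℝ (MultilinearMap ℝ (fun _ : Fin n => Loc N) (Loc N)) where
  carrier := {A | IsLDO A}
  zero_mem' := ⟨0, fun m => by simp, fun f => by simp⟩
  add_mem' := by
    rintro A B ⟨p, hp, hA⟩ ⟨r, hr, hB⟩
    refine ⟨p + r, fun m => ((hp m).union (hr m)).subset ?_, fun f => ?_⟩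
    · rintro q ⟨hq, hne⟩
      by_cases h : p q = 0
      · exact Or.inr ⟨hq, fun h' => hne (by simp [h, h'])⟩
      · exact Or.inl ⟨hq, h⟩
    · simp only [add_apply, Pi.add_apply, add_mul, hA, hB]
      rw [finsum_add_distrib (finite_support_mul hp f) (finite_support_mul hr f)]
  smul_mem' := by
    rintro c A ⟨p, hp, hA⟩
    refine ⟨c • p, fun m => (hp m).subset ?_, fun f => ?_⟩
    · rintro q ⟨hq, hne⟩
      exact ⟨hq, fun h' => hne (by simp [h'])⟩
    · simp only [smul_apply, Pi.smul_apply, smul_mul_assoc, hA]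
      rw [smul_finsum' c (finite_support_mul hp f)]

theorem totalDerivPow_raise {N : ℕ} (i : Fin N) (I : MultiIndex N) (f : Loc N) :
    totalDerivPow (raise i I) f = totalDeriv i (totalDerivPow I f) := by
  have h : totalDerivPow (raise i I) = totalDeriv i * totalDerivPow I := by
    rw [totalDerivPow, totalDerivPow,
      ← Finset.mul_noncommProd_erase _ (Finset.mem_univ i) _ (totalDerivPow_pairwise (raise i I) _),
      ← Finset.mul_noncommProd_erase _ (Finset.mem_univ i) _ (totalDerivPow_pairwise I _),
      ← mul_assoc]
    congr 1
    · rw [← pow_succ']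
      simp [raise]
    · refine Finset.noncommProd_congr rfl (fun j hj => ?_) _
      have : j ≠ i := Finset.ne_of_mem_erase hj
      simp [raise, this]
  rw [h]
  rfl

theorem totalDeriv_prod {N n : ℕ} (i : Fin N) (s : Finset (Fin n)) (g : Fin n → Loc N) :
    totalDeriv i (∏ j ∈ s, g j) = ∑ j ∈ s, (∏ k ∈ s.erase j, g k) * totalDeriv i (g j) := by
  induction s using Finset.induction_on with
  | empty =>
    have h := totalDeriv_mul i (1 : Loc N) 1
    simp only [mul_one, one_mul] at h
    simpa using h
  | insert a s ha ih =>
    rw [Finset.prod_insert ha, totalDeriv_mul, ih, Finset.sum_insert ha, Finset.erase_insert ha,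
      Finset.mul_sum]
    congr 1
    · ring
    · refine Finset.sum_congr rfl fun j hj => ?_
      have hja : a ≠ j := fun h => ha (h ▸ hj)
      rw [Finset.erase_insert_of_ne hja, Finset.prod_insert fun h => ha (Finset.mem_of_mem_erase h)]
      ring

/-- Raise the `i`-th entry of `I_j` by one. -/
def raiseTerm {N n : ℕ} (i : Fin N) (j : Fin n) (q : TermIndex N n) : TermIndex N n :=
  (Function.update q.1 j (raise i (q.1 j)), q.2)

theorem raiseTerm_injective {N n : ℕ} (i : Fin N) (j : Fin n) :
    Function.Injective (raiseTerm (n := n) i j) := by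
  rintro ⟨I, α⟩ ⟨I', α'⟩ h
  simp only [raiseTerm, Prod.mk.injEq] at h
  refine Prod.ext (funext fun k => ?_) h.2
  have hk := congrFun h.1 k
  by_cases hkj : k = j
  · subst hkj
    simpa [raise] using hk
  · simpa [hkj] using hk

theorem totalDeriv_termValue {N n : ℕ} (i : Fin N) (q : TermIndex N n) (f : Fin n → Loc N) :
    totalDeriv i (termValue q f) = ∑ j, termValue (raiseTerm i j q) f := by
  rw [termValue, totalDeriv_prod]
  refine Finset.sum_congr rfl fun j _ => ?_
  rw [termValue, ← Finset.prod_erase_mul _ _ (Finset.mem_univ j)]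
  congr 1
  · refine Finset.prod_congr rfl fun k hk => ?_
    simp [raiseTerm, Finset.ne_of_mem_erase hk]
  · simp [raiseTerm, totalDerivPow_raise]

theorem FiniteInEachDegree.extend {N n : ℕ} {p : TermIndex N n → Loc N}
    (hp : FiniteInEachDegree p) (i : Fin N) (j : Fin n) :
    FiniteInEachDegree (Function.extend (raiseTerm i j) p 0) := by
  refine fun m => ((hp m).image (raiseTerm i j)).subset ?_
  rintro q ⟨hq, hne⟩
  by_cases h : ∃ q', raiseTerm i j q' = q
  · obtain ⟨q', rfl⟩ := h
    rw [(raiseTerm_injective i j).extend_apply] at hne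
    exact ⟨q', ⟨hq, hne⟩, rfl⟩
  · exact absurd (Function.extend_apply' _ _ _ h) hne

theorem finsum_extend_raiseTerm {N n : ℕ} (p : TermIndex N n → Loc N) (i : Fin N) (j : Fin n)
    (f : Fin n → Loc N) :
    ∑ᶠ q, Function.extend (raiseTerm i j) p 0 q * termValue q f =
      ∑ᶠ q, p q * termValue (raiseTerm i j q) f := by
  rw [← finsum_mem_univ, finsum_mem_inter_support_eq _ _
    (Set.range (raiseTerm (n := n) i j)), finsum_mem_range (raiseTerm_injective i j)]
  · simp only [(raiseTerm_injective i j).extend_apply]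
  · ext q
    simp only [Set.mem_inter_iff, Set.mem_univ, true_and, iff_and_self]
    intro hq
    by_contra h
    have h0 : Function.extend (raiseTerm i j) p 0 q = 0 := Function.extend_apply' _ _ _ h
    exact hq (by simp only [h0, zero_mul])

theorem isLDO_totalDeriv_comp {N n : ℕ} {A : MultilinearMap ℝ (fun _ : Fin n => Loc N) (Loc N)}
    (hA : IsLDO A) (i : Fin N) : IsLDO ((totalDeriv i).compMultilinearMap A) := by
  obtain ⟨p, hp, hA⟩ := hA
  have hDp : FiniteInEachDegree fun q => totalDeriv i (p q) := fun m =>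
    (hp m).subset fun q hq => ⟨hq.1, fun h => hq.2 (by simp only [h, map_zero])⟩
  refine ⟨fun q => totalDeriv i (p q) + ∑ j, Function.extend (raiseTerm i j) p 0 q,
    fun m => ?_, fun f => ?_⟩
  · refine ((hDp m).union (Set.finite_iUnion fun j : Fin n => hp.extend i j m)).subset ?_
    rintro q ⟨hq, hne⟩
    by_cases h : totalDeriv i (p q) = 0
    · simp only [h, zero_add] at hne
      obtain ⟨j, _, hj⟩ := Finset.exists_ne_zero_of_sum_ne_zero hne
      exact Or.inr (Set.mem_iUnion.2 ⟨j, hq, hj⟩)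
    · exact Or.inl ⟨hq, h⟩
  · have hfin : ∀ j, (Function.support fun q =>
        Function.extend (raiseTerm i j) p 0 q * termValue q f).Finite := fun j =>
      finite_support_mul (hp.extend i j) f
    have hfin' : ∀ j, (Function.support fun q => p q * termValue (raiseTerm i j q) f).Finite := by
      intro j
      refine ((hfin j).preimage (raiseTerm_injective i j).injOn).subset fun q hq => ?_
      simpa [(raiseTerm_injective i j).extend_apply] using hq
    change totalDeriv i (A f) = _
    rw [hA, ← LinearMap.toAddMonoidHom_coe (totalDeriv i),
      AddMonoidHom.map_finsum _ (finite_support_mul hp f)]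
    simp only [LinearMap.toAddMonoidHom_coe, totalDeriv_mul, totalDeriv_termValue, add_mul,
      Finset.sum_mul, Finset.mul_sum]
    rw [finsum_add_distrib (finite_support_mul hDp f), finsum_add_distrib (finite_support_mul hDp f),
      finsum_sum_comm _ _ fun j _ => hfin' j, finsum_sum_comm _ _ fun j _ => hfin j]
    · simp only [finsum_extend_raiseTerm]
    · refine (Set.finite_iUnion hfin).subset fun q hq => ?_
      obtain ⟨j, _, hj⟩ := Finset.exists_ne_zero_of_sum_ne_zero hq
      exact Set.mem_iUnion.2 ⟨j, hj⟩
    · refine (Set.finite_iUnion hfin').subset fun q hq => ?_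
      obtain ⟨j, _, hj⟩ := Finset.exists_ne_zero_of_sum_ne_zero hq
      exact Set.mem_iUnion.2 ⟨j, hj⟩

/-- The operator `A ↦ (d/dx^i) ∘ A` on `LDO(n)`. -/
def totalDerivLDO {N n : ℕ} (i : Fin N) : LDO N n →ₗ[ℝ] LDO N n where
  toFun A := ⟨(totalDeriv i).compMultilinearMap A.1, isLDO_totalDeriv_comp A.2 i⟩
  map_add' A B := by
    ext f : 2
    exact map_add (totalDeriv i) (A.1 f) (B.1 f)
  map_smul' c A := by
    ext f : 2
    exact map_smul (totalDeriv i) c (A.1 f)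

/-! ### Horizontal forms and the operator complex -/

/-- Horizontal `k`-forms `∑ θ_s (dx)^s` with coefficients in `V`, where `s` runs over the
`k`-element subsets of `{1, …, N}` and `(dx)^s` is the wedge product of the `dx^i`, `i ∈ s`,
in increasing order of `i`. -/
abbrev HForm (N k : ℕ) (V : Type*) := {s : Finset (Fin N) // s.card = k} → V

/-- The differential `θ (dx)^t ↦ ∑_i (D_i θ) dx^i ∧ (dx)^t` in terms of coefficients: as
`dx^i ∧ (dx)^t = (-1)^#{j ∈ t | j < i} (dx)^(t ∪ {i})` for `i ∉ t`, the coefficient at `(dx)^s`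
is `∑_{i ∈ s} (-1)^#{j ∈ s | j < i} D_i θ_{s \ {i}}`. -/
def formDiff {N : ℕ} {V : Type*} [AddCommMonoid V] [Module ℝ V] (D : Fin N → V →ₗ[ℝ] V)
    {k l : ℕ} (h : k + 1 = l) : HForm N k V →ₗ[ℝ] HForm N l V where
  toFun θ s := ∑ i : {i // i ∈ s.1}, (-1 : ℝ) ^ (s.1.filter (· < i.1)).card •
    D i (θ ⟨s.1.erase i, by rw [Finset.card_erase_of_mem i.2, s.2]; omega⟩)
  map_add' θ η := by
    funext s
    simp [Finset.sum_add_distrib]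
  map_smul' c θ := by
    funext s
    simp [Finset.smul_sum, smul_comm c]

/-- The forms `Ω^{k,0}(J^∞ E)`. -/
abbrev HorizontalForm (N k : ℕ) := HForm N k (Loc N)

/-- The horizontal differential `d_H : Ω^{k,0} → Ω^{k+1,0}`. -/
def dH {N k l : ℕ} (h : k + 1 = l) : HorizontalForm N k →ₗ[ℝ] HorizontalForm N l :=
  formDiff totalDeriv h

/-- The component `O^k(n)` of the operator complex: `k`-forms with coefficients in `LDO(n)`. -/
abbrev OperatorForm (N n k : ℕ) := HForm N k (LDO N n)

/-- The differential `d(A (dx)^t) = ∑_i (d/dx^i ∘ A) dx^i ∧ (dx)^t` of the operator complex. -/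
def operatorDiff {N n k l : ℕ} (h : k + 1 = l) : OperatorForm N n k →ₗ[ℝ] OperatorForm N n l :=
  formDiff totalDerivLDO h

/-- The value `A(f₁, …, f_n) ∈ Ω^{k,0}` of an element `A ∈ O^k(n)`. -/
def OperatorForm.value {N n k : ℕ} (A : OperatorForm N n k) (f : Fin n → Loc N) :
    HorizontalForm N k :=
  fun s => (A s).1 f

end JetCalculus

end

noncomputable section

namespace JetCalculus

open scoped ContDiff

/-! ### Multi-indices -/

/-! In top degree, being exact just means that the single coefficient is a divergence `∑ i, D_i
b_i`, with `b_i` local functions on one side of the equivalence and operators on the other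
(`mem_range_formDiff_top`). Evaluating operators gives one direction at once. For the converse the
`b_i` depend on `f` in an arbitrary way, so they cannot simply be assembled into operators.

If `n = 0`, an operator is a single local function and there is nothing to assemble. If `n > 0`,
integration by parts writes `A = R + ∑ i, D_i ∘ B_i`, where `R` takes no total derivatives of one
chosen argument (`LDO.exists_integration_by_parts`). The values of `R` are again divergences, and
the claim is that `R = 0`.

In the chosen argument `R` involves only the `∂/∂u_J`, hence commutes with multiplication by each
`x^i`. Its values, as that argument varies, therefore form a set of divergences stable under
multiplication by the `x^i`. The Euler operator `∑_J (-1)^|J| D^J ∂/∂u_J` kills divergences.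
Commuting it repeatedly with the `x^i` gives operators `∑_J c_J D^J ∂/∂u_{J+I}`, all `c_J ≠ 0`,
which kill the same set. Descending induction on `|I|` then shows that every value is independent of
all `u_I` (`fibreDeriv_eq_zero_of_divergences`).

Finally, `R` is local on the jet space itself, so a cutoff in `u_0` alters the argument at a distant
fibre point without affecting it near a given one. A value independent of `u_0` can then be computed
where the argument vanishes, so it is zero (`ofCoeff_eq_zero_of_divergences`). -/

theorem raise_injective {N : ℕ} (i : Fin N) : Function.Injective (raise i) :=
  add_left_injective _

theorem order_raise {N : ℕ} (i : Fin N) (J : MultiIndex N) : order (raise i J) = order J + 1 := by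
  simp [order, raise, Finset.sum_add_distrib]

theorem order_add {N : ℕ} (I J : MultiIndex N) : order (I + J) = order I + order J := by
  simp [order, Finset.sum_add_distrib]

theorem order_eq_zero {N : ℕ} {J : MultiIndex N} : order J = 0 ↔ J = 0 := by
  simp [order, funext_iff]

theorem raise_sub_single {N : ℕ} {i : Fin N} {J : MultiIndex N} (h : J i ≠ 0) :
    raise i (J - Pi.single i 1) = J := by
  refine tsub_add_cancel_of_le fun k => ?_
  by_cases hk : k = i
  · subst hk
    simpa using Nat.one_le_iff_ne_zero.2 h
  · simp [hk]

theorem raise_sub_self {N : ℕ} (i : Fin N) (J : MultiIndex N) :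
    raise i J - Pi.single i 1 = J := add_tsub_cancel_right _ _

theorem raise_comm {N : ℕ} (i j : Fin N) (J : MultiIndex N) :
    raise i (raise j J) = raise j (raise i J) := by
  simp only [raise, add_assoc, add_comm (Pi.single i 1 : MultiIndex N)]

theorem MultiIndex.induction {N : ℕ} {P : MultiIndex N → Prop} (zero : P 0)
    (step : ∀ i J, P J → P (raise i J)) (J : MultiIndex N) : P J := by
  induction h : order J generalizing J with
  | zero => rwa [order_eq_zero.1 h]
  | succ s ih =>
    obtain ⟨i, hi⟩ : ∃ i, J i ≠ 0 := by
      by_contra! h'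
      rw [order_eq_zero.2 (funext h')] at h
      omega
    rw [← raise_sub_single hi] at h ⊢
    rw [order_raise] at h
    exact step _ _ (ih _ (by omega))

/-- Used to reindex sums over multi-indices along `raise i` when the terms with `J i = 0` vanish. -/
theorem finsum_eq_finsum_comp {α β M : Type*} [AddCommMonoid M] {e : α → β}
    (he : Function.Injective e) {h : β → M} (hs : Function.support h ⊆ Set.range e) :
    ∑ᶠ b, h b = ∑ᶠ a, h (e a) := by
  rw [← finsum_mem_univ, finsum_mem_inter_support_eq _ _ (Set.range e), finsum_mem_range he]
  rw [Set.univ_inter, Set.inter_eq_right.2 hs]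

/-! ### Commutation relations -/

theorem totalDerivPow_zero {N : ℕ} : totalDerivPow (0 : MultiIndex N) = 1 := by
  simp only [totalDerivPow, Pi.zero_apply, pow_zero]
  exact (Finset.noncommProd_eq_pow_card _ _ _ 1 fun _ _ => rfl).trans (one_pow _)

theorem totalDerivPow_totalDeriv {N : ℕ} (i : Fin N) (J : MultiIndex N) (f : Loc N) :
    totalDerivPow J (totalDeriv i f) = totalDeriv i (totalDerivPow J f) := by
  induction J using MultiIndex.induction with
  | zero => simp [totalDerivPow_zero]
  | step j J ih =>
    rw [totalDerivPow_raise, totalDerivPow_raise, ih]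
    exact LinearMap.congr_fun (totalDeriv_comm j i) _

/-- The commutator comes from differentiating the coefficients `u_{iL}` of the total derivative:
only the `L` with `iL = J` contributes, and it exists exactly when `J i ≠ 0`. -/
theorem fibreDeriv_totalDeriv {N : ℕ} (i : Fin N) (J : MultiIndex N) (f : Loc N) :
    fibreDeriv J (totalDeriv i f) = totalDeriv i (fibreDeriv J f) +
      if J i = 0 then 0 else fibreDeriv (J - Pi.single i 1) f := by
  obtain ⟨k, hf⟩ := exists_order f
  have hd : IsLocalOfOrder k (fibreDeriv J f).1 := isLocalOfOrder_lineDeriv hf _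
  have e1 : fibreDeriv J (baseDeriv i f) = baseDeriv i (fibreDeriv J f) := dirDeriv_comm _ _ _
  have e2 : ∀ L, fibreDeriv J (coordU (raise i L) * fibreDeriv L f) =
      coordU (raise i L) * fibreDeriv L (fibreDeriv J f) +
        if raise i L = J then fibreDeriv L f else 0 := by
    intro L
    have h : fibreDeriv J (fibreDeriv L f) = fibreDeriv L (fibreDeriv J f) := dirDeriv_comm _ _ _
    have h' : fibreDeriv J (coordU (raise i L)) = if raise i L = J then 1 else 0 := by
      rw [fibreDeriv, dirDeriv_coordU]
      by_cases hL : raise i L = J <;> simp [fibreDir, hL]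
    change dirDeriv (fibreDir J) _ = _
    rw [dirDeriv_mul]
    change fibreDeriv J _ * _ + _ * fibreDeriv J _ = _
    rw [h, h', add_comm]
    split_ifs <;> simp
  rw [totalDeriv_eq i f hf, totalDeriv_eq i _ hd, map_add, map_sum, e1, add_assoc]
  simp only [e2, Finset.sum_add_distrib]
  congr 2
  split_ifs with h
  · refine Finset.sum_eq_zero fun L _ => if_neg ?_
    rintro rfl
    simp [raise] at h
  · rw [Finset.sum_eq_single (J - Pi.single i 1), if_pos (raise_sub_single h)]
    · intro L _ hL
      refine if_neg ?_
      rintro rfl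
      exact hL (raise_sub_self i L).symm
    -- If `J` lowered at `i` has order above `k`, the finite sum misses it, but `f` does not depend
    -- on that coordinate.
    · intro hL
      rw [if_pos (raise_sub_single h)]
      exact fibreDeriv_eq_zero hf (not_le.1 fun h' => hL (mem_multiIndicesLE.2 h'))

/-! ### Multiplication by the base coordinates -/

/-- The coordinate function `x^i`. -/
def coordX {N : ℕ} (i : Fin N) : Loc N :=
  ⟨fun p => p.1 i, 0, fun q => q.1 i, (contDiff_apply ℝ ℝ _).comp contDiff_fst, rfl⟩

theorem dirDeriv_coordX {N : ℕ} (v : InfJet N) (i : Fin N) :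
    dirDeriv v (coordX i) = algebraMap ℝ (Loc N) (v.1 i) := by
  ext p
  change lineDeriv ℝ (fun p : InfJet N => p.1 i) p v = v.1 i
  simp [lineDeriv]

theorem fibreDeriv_coordX {N : ℕ} (J : MultiIndex N) (i : Fin N) :
    fibreDeriv J (coordX i) = 0 := by
  simp [fibreDeriv, dirDeriv_coordX, fibreDir]

theorem totalDeriv_coordX {N : ℕ} (i j : Fin N) :
    totalDeriv i (coordX j) = if i = j then 1 else 0 := by
  change baseDeriv i (coordX j) + ∑ᶠ L, coordU (raise i L) * fibreDeriv L (coordX j) = _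
  by_cases h : i = j
  · simp [fibreDeriv_coordX, baseDeriv, dirDeriv_coordX, baseDir, h]
  · simp [fibreDeriv_coordX, baseDeriv, dirDeriv_coordX, baseDir, h, Ne.symm h]

theorem fibreDeriv_coordX_mul {N : ℕ} (J : MultiIndex N) (i : Fin N) (f : Loc N) :
    fibreDeriv J (coordX i * f) = coordX i * fibreDeriv J f := by
  change dirDeriv _ _ = _
  rw [dirDeriv_mul]
  change fibreDeriv J _ * _ + _ * fibreDeriv J _ = _
  simp [fibreDeriv_coordX]

/-- Leibniz rule with `D_i x^i = 1`. For `J i = 0` the truncated subtraction returns `J` itself,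
which is harmless because its coefficient is zero. -/
theorem totalDerivPow_coordX_mul {N : ℕ} (i : Fin N) (J : MultiIndex N) (f : Loc N) :
    totalDerivPow J (coordX i * f) = coordX i * totalDerivPow J f +
      (J i : ℝ) • totalDerivPow (J - Pi.single i 1) f := by
  induction J using MultiIndex.induction with
  | zero => simp [totalDerivPow_zero]
  | step j J ih =>
    rw [totalDerivPow_raise, ih, map_add, map_smul, totalDeriv_mul, totalDeriv_coordX,
      ← totalDerivPow_raise, ← totalDerivPow_raise]
    by_cases h : j = i
    · subst h
      rw [raise_sub_self]
      have : (J j : ℝ) • totalDerivPow (raise j (J - Pi.single j 1)) f =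
          (J j : ℝ) • totalDerivPow J f := by
        by_cases h : J j = 0
        · simp [h]
        · rw [raise_sub_single h]
      rw [this]
      simp [raise, add_smul]
      abel
    · have : (J i : ℝ) • totalDerivPow (raise j (J - Pi.single i 1)) f =
          (J i : ℝ) • totalDerivPow (raise j J - Pi.single i 1) f := by
        by_cases hi : J i = 0
        · simp [hi]
        · have e : raise j J - Pi.single i 1 = raise j (J - Pi.single i 1) := by
            conv_lhs => rw [← raise_sub_single hi, raise_comm, raise_sub_self]
          rw [e]
      rw [this]
      simp [raise, h, Ne.symm h]

/-! ### The Euler operator -/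

/-- The operator `∑_J c_J (d/dx)^J ∂/∂u_{J + I}`. -/
def eulerSum {N : ℕ} (c : MultiIndex N → ℝ) (I : MultiIndex N) (f : Loc N) : Loc N :=
  ∑ᶠ J, c J • totalDerivPow J (fibreDeriv (J + I) f)

/-- A function of order `k` does not see `u_{J+I}` once `|J| > k`. The family `T` is arbitrary so
that this justifies every splitting of the sums below. -/
theorem finite_support_fibreDeriv {N : ℕ} (I : MultiIndex N) (f : Loc N)
    (T : MultiIndex N → Loc N →ₗ[ℝ] Loc N) :
    (Function.support fun J => T J (fibreDeriv (J + I) f)).Finite := by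
  obtain ⟨k, hk⟩ := exists_order f
  refine (multiIndicesLE N k).finite_toSet.subset fun J hJ => ?_
  by_contra h
  have hlt : k < order J := not_le.1 fun h' => h (mem_multiIndicesLE.2 h')
  refine hJ ?_
  simp only
  rw [fibreDeriv_eq_zero hk (by rw [order_add]; omega), map_zero]

/-- The commutator with `x^i` removes one `D_i` from `(d/dx)^J` with weight `J i`. Reindexing by
`raise i` turns the removed index into a raised `I`, and the weight becomes `J i + 1`, which never
vanishes. -/
theorem eulerSum_coordX_mul {N : ℕ} (c : MultiIndex N → ℝ) (I : MultiIndex N) (i : Fin N)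
    (f : Loc N) : eulerSum c I (coordX i * f) = coordX i * eulerSum c I f +
      eulerSum (fun J => c (raise i J) * (J i + 1)) (raise i I) f := by
  have h1 := finite_support_fibreDeriv I f fun J =>
    LinearMap.mulLeft ℝ (coordX i) ∘ₗ (c J • totalDerivPow J)
  have h2 := finite_support_fibreDeriv I f fun J =>
    ((c J * J i : ℝ) • (totalDerivPow (J - Pi.single i 1) : Loc N →ₗ[ℝ] Loc N))
  simp only [LinearMap.comp_apply, LinearMap.smul_apply, LinearMap.mulLeft_apply] at h1 h2
  have h3 : coordX i * eulerSum c I f =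
      ∑ᶠ J, coordX i * c J • totalDerivPow J (fibreDeriv (J + I) f) :=
    AddMonoidHom.map_finsum (AddMonoidHom.mulLeft (coordX i))
      (finite_support_fibreDeriv I f fun J => c J • totalDerivPow J)
  have h4 : eulerSum (fun J => c (raise i J) * (J i + 1)) (raise i I) f =
      ∑ᶠ J, (c J * J i) • totalDerivPow (J - Pi.single i 1) (fibreDeriv (J + I) f) := by
    rw [finsum_eq_finsum_comp (raise_injective i), eulerSum]
    · refine finsum_congr fun J => ?_
      rw [raise_sub_self, show raise i J + I = J + raise i I by simp only [raise]; abel]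
      simp [raise]
    · intro J hJ
      refine ⟨J - Pi.single i 1, raise_sub_single fun h => hJ ?_⟩
      simp [h]
  rw [h3, h4, ← finsum_add_distrib h1 h2]
  refine finsum_congr fun J => ?_
  rw [fibreDeriv_coordX_mul, totalDerivPow_coordX_mul, smul_add, smul_smul, mul_smul_comm]

/-- Telescoping: the commutator term at `raise i J` equals the main term at `J` up to the sign
`(-1)^|J|`, which flips when the order grows by one. -/
theorem eulerSum_totalDeriv {N : ℕ} (i : Fin N) (f : Loc N) :
    eulerSum (fun J => (-1) ^ order J) 0 (totalDeriv i f) = 0 := by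
  set c : MultiIndex N → ℝ := fun J => (-1) ^ order J
  have h1 := finite_support_fibreDeriv 0 f fun J => c J • totalDerivPow (raise i J)
  simp only [LinearMap.smul_apply, add_zero] at h1
  set g : MultiIndex N → Loc N := fun J =>
    c J • totalDerivPow J (if J i = 0 then 0 else fibreDeriv (J - Pi.single i 1) f) with hg
  have hgr : ∀ J, g (raise i J) = -(c J • totalDerivPow (raise i J) (fibreDeriv J f)) := by
    intro J
    have : raise i J i ≠ 0 := by simp [raise]
    simp only [hg, if_neg this, raise_sub_self, c, order_raise, pow_succ]
    simp
  have hgs : Function.support g ⊆ Set.range (raise i) := by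
    intro J hJ
    refine ⟨J - Pi.single i 1, raise_sub_single fun h => hJ ?_⟩
    simp [hg, h]
  have hgf : (Function.support g).Finite := by
    refine (h1.image (raise i)).subset fun J hJ => ?_
    obtain ⟨L, rfl⟩ := hgs hJ
    refine ⟨L, fun h => hJ ?_, rfl⟩
    rw [hgr]
    exact neg_eq_zero.2 h
  have : eulerSum c 0 (totalDeriv i f) =
      ∑ᶠ J, (c J • totalDerivPow (raise i J) (fibreDeriv J f) + g J) := by
    refine finsum_congr fun J => ?_
    rw [add_zero, fibreDeriv_totalDeriv, map_add, smul_add, totalDerivPow_totalDeriv,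
      totalDerivPow_raise]
  rw [this, finsum_add_distrib h1 hgf, finsum_eq_finsum_comp (raise_injective i) hgs]
  simp only [hgr]
  rw [finsum_neg_distrib, add_neg_cancel]

theorem eulerSum_add {N : ℕ} (c : MultiIndex N → ℝ) (I : MultiIndex N) (f g : Loc N) :
    eulerSum c I (f + g) = eulerSum c I f + eulerSum c I g := by
  simp only [eulerSum, map_add, smul_add]
  exact finsum_add_distrib (finite_support_fibreDeriv I f fun J => c J • totalDerivPow J)
    (finite_support_fibreDeriv I g fun J => c J • totalDerivPow J)

theorem eulerSum_sum_totalDeriv {N : ℕ} (b : Fin N → Loc N) :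
    eulerSum (fun J => (-1) ^ order J) 0 (∑ i, totalDeriv i (b i)) = 0 := by
  refine Finset.sum_induction _
    (fun f => eulerSum (fun J : MultiIndex N => (-1) ^ order J) 0 f = 0) ?_ ?_ ?_
  · intro f g hf hg
    rw [eulerSum_add, hf, hg, add_zero]
  · simp [eulerSum]
  · intro i _
    exact eulerSum_totalDeriv i _

/-- A set of divergences which is stable under multiplication by the coordinates `x^i` consists
of functions of `x` alone. -/
theorem fibreDeriv_eq_zero_of_divergences {N : ℕ} {S : Set (Loc N)}
    (hmul : ∀ i, ∀ f ∈ S, coordX i * f ∈ S)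
    (hdiv : ∀ f ∈ S, ∃ b : Fin N → Loc N, f = ∑ i, totalDeriv i (b i)) {f : Loc N} (hf : f ∈ S)
    (I : MultiIndex N) : fibreDeriv I f = 0 := by
  -- The coefficients are left unspecified, as only their nonvanishing matters. The step applies the
  -- hypothesis to `x^i f` as well as to `f`, hence the quantification over all of `S`.
  have key : ∀ I : MultiIndex N, ∃ c : MultiIndex N → ℝ, (∀ J, c J ≠ 0) ∧
      ∀ f ∈ S, eulerSum c I f = 0 := by
    intro I
    induction I using MultiIndex.induction with
    | zero =>
      refine ⟨fun J => (-1) ^ order J, fun J => pow_ne_zero _ (by norm_num), fun f hf => ?_⟩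
      obtain ⟨b, rfl⟩ := hdiv f hf
      exact eulerSum_sum_totalDeriv b
    | step i I ih =>
      obtain ⟨c, hc, hS⟩ := ih
      refine ⟨fun J => c (raise i J) * (J i + 1), fun J => mul_ne_zero (hc _) (by positivity),
        fun f hf => ?_⟩
      have h := eulerSum_coordX_mul c I i f
      rwa [hS _ (hmul i f hf), hS f hf, mul_zero, zero_add, eq_comm] at h
  obtain ⟨k, hk⟩ := exists_order f
  -- Descending induction on the order of `I`, starting above the order of `f`: all terms with `J ≠
  -- 0` involve higher coordinates and are already zero, leaving `c 0 • fibreDeriv I f = 0`.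
  have desc : ∀ d, ∀ I : MultiIndex N, k < order I + d → fibreDeriv I f = 0 := by
    intro d
    induction d with
    | zero => exact fun I hI => fibreDeriv_eq_zero hk hI
    | succ d ih =>
      intro I hI
      obtain ⟨c, hc, hS⟩ := key I
      have h := hS f hf
      rw [eulerSum, finsum_eq_single _ 0] at h
      · simpa [totalDerivPow_zero, hc 0] using h
      · intro J hJ
        have : order J ≠ 0 := fun h => hJ (order_eq_zero.1 h)
        rw [ih (J + I) (by rw [order_add]; omega), map_zero, smul_zero]
  exact desc (k + 1) I (by omega)

/-! ### Operators from coefficients -/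

/-- The total formal degree `∑ deg_f(α_j)` of a term. -/
def totalDegree {N n : ℕ} (q : TermIndex N n) : ℕ := ∑ j, formalDegree (q.2 j)

theorem termValue_eq_zero {N n : ℕ} {f : Fin n → Loc N} {k : Fin n → ℕ}
    (hk : ∀ j, IsLocalOfOrder (k j) (f j).1) {q : TermIndex N n} (hq : ∑ j, k j < totalDegree q) :
    termValue q f = 0 := by
  obtain ⟨j, _, hj⟩ := Finset.exists_lt_of_sum_lt hq
  refine Finset.prod_eq_zero (Finset.mem_univ j) ?_
  rw [fibreDerivPow_eq_zero (hk j) hj, map_zero]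

/-- The multilinear map `f ↦ termValue q f`. -/
def termMap {N n : ℕ} (q : TermIndex N n) : MultilinearMap ℝ (fun _ : Fin n => Loc N) (Loc N) :=
  (MultilinearMap.mkPiAlgebra ℝ (Fin n) (Loc N)).compLinearMap
    fun j => (totalDerivPow (q.1 j) : Loc N →ₗ[ℝ] Loc N) ∘ₗ fibreDerivPow (q.2 j)

theorem termMap_apply {N n : ℕ} (q : TermIndex N n) (f : Fin n → Loc N) :
    termMap q f = termValue q f := by
  simp [termMap, termValue]

/-- The operator with given coefficients. -/
def LDO.ofCoeff {N n : ℕ} (p : TermIndex N n → Loc N) (hp : FiniteInEachDegree p) : LDO N n :=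
  ⟨{  toFun := fun f => ∑ᶠ q, p q * termValue q f
      map_update_add' := fun f j x y => by
        rw [← finsum_add_distrib (finite_support_mul hp _) (finite_support_mul hp _)]
        refine finsum_congr fun q => ?_
        simp only [← termMap_apply]
        rw [MultilinearMap.map_update_add, mul_add]
      map_update_smul' := fun f j c x => by
        rw [smul_finsum' c (finite_support_mul hp _)]
        refine finsum_congr fun q => ?_
        simp only [← termMap_apply]
        rw [MultilinearMap.map_update_smul, mul_smul_comm] }, p, hp, fun _ => rfl⟩

theorem LDO.ofCoeff_apply {N n : ℕ} (p : TermIndex N n → Loc N) (hp : FiniteInEachDegree p)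
    (f : Fin n → Loc N) : (LDO.ofCoeff p hp).1 f = ∑ᶠ q, p q * termValue q f := rfl

/-- The value at `f` of the operator with finitely many given coefficients. -/
def evalTerms {N n : ℕ} (f : Fin n → Loc N) : (TermIndex N n →₀ Loc N) →ₗ[Loc N] Loc N :=
  Finsupp.linearCombination (Loc N) fun q => termValue q f

theorem evalTerms_single {N n : ℕ} (f : Fin n → Loc N) (q : TermIndex N n) (c : Loc N) :
    evalTerms f (Finsupp.single q c) = c * termValue q f := by
  simp [evalTerms]

theorem evalTerms_eq_sum {N n : ℕ} (f : Fin n → Loc N) (p : TermIndex N n →₀ Loc N) :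
    evalTerms f p = ∑ q ∈ p.support, p q * termValue q f := rfl

/-- The coefficient functions homogeneous of degree `m`. -/
abbrev homogeneousTerms (N n m : ℕ) : Submodule (Loc N) (TermIndex N n →₀ Loc N) :=
  Finsupp.supported (Loc N) (Loc N) {q | totalDegree q = m}

/-- The coefficient function with the given homogeneous parts. -/
def glueTerms {N n : ℕ} (s : ℕ → TermIndex N n →₀ Loc N) (q : TermIndex N n) : Loc N :=
  s (totalDegree q) q

theorem finiteInEachDegree_glueTerms {N n : ℕ} (s : ℕ → TermIndex N n →₀ Loc N) :
    FiniteInEachDegree (glueTerms s) := by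
  intro m
  refine ((Finset.range (m + 1)).biUnion fun d => (s d).support).finite_toSet.subset ?_
  rintro q ⟨hq, hne⟩
  simp only [Finset.coe_biUnion, Set.mem_iUnion, Finset.mem_coe, Finsupp.mem_support_iff]
  exact ⟨totalDegree q, Finset.mem_range.2 (Nat.lt_succ_of_le hq), hne⟩

/-- On fixed arguments only formal degrees up to the sum of their orders act. An infinite operator
can thus be handled one finite homogeneous part at a time. -/
theorem finsum_glueTerms {N n : ℕ} {s : ℕ → TermIndex N n →₀ Loc N}
    (hs : ∀ m, s m ∈ homogeneousTerms N n m) {f : Fin n → Loc N} {k : Fin n → ℕ}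
    (hk : ∀ j, IsLocalOfOrder (k j) (f j).1) :
    ∑ᶠ q, glueTerms s q * termValue q f =
      ∑ m ∈ Finset.range (∑ j, k j + 1), evalTerms f (s m) := by
  set R := Finset.range (∑ j, k j + 1)
  set F : Finset (TermIndex N n) := R.biUnion fun d => (s d).support with hF
  have hdeg : ∀ m q, s m q ≠ 0 → totalDegree q = m := fun m q h =>
    (Finsupp.mem_supported _ _).1 (hs m) (Finsupp.mem_support_iff.2 h)
  rw [finsum_eq_sum_of_support_subset (s := F)]
  · have : ∀ m ∈ R, evalTerms f (s m) = ∑ q ∈ F, s m q * termValue q f := by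
      intro m hm
      rw [evalTerms_eq_sum]
      refine Finset.sum_subset (Finset.subset_biUnion_of_mem (fun d => (s d).support) hm) ?_
      intro q _ hq
      rw [Finsupp.notMem_support_iff.1 hq, zero_mul]
    rw [Finset.sum_congr rfl this, Finset.sum_comm]
    refine Finset.sum_congr rfl fun q hq => ?_
    obtain ⟨m, hm, hqm⟩ := Finset.mem_biUnion.1 hq
    have hd := hdeg m q (Finsupp.mem_support_iff.1 hqm)
    rw [Finset.sum_eq_single (totalDegree q)]
    · rfl
    · intro d _ hne
      by_cases h : s d q = 0
      · rw [h, zero_mul]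
      · exact absurd (hdeg d q h).symm hne
    · exact fun h => absurd (hd ▸ hm) h
  · intro q hq
    refine Finset.mem_coe.2 (Finset.mem_biUnion.2 ⟨totalDegree q, ?_, ?_⟩)
    · refine Finset.mem_range.2 (Nat.lt_succ_of_le (not_lt.1 fun h => hq ?_))
      simp only [termValue_eq_zero hk h, mul_zero]
    · exact Finsupp.mem_support_iff.2 (left_ne_zero_of_mul hq)

/-! ### Integration by parts -/

/-- The function `F` of `f₁, …, f_n` is, up to total derivatives of operators of degree `m`, given
by an operator of degree `m` which does not take total derivatives of the `j`-th argument. -/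
def ReducibleByParts {N n : ℕ} (m : ℕ) (j : Fin n) (F : (Fin n → Loc N) → Loc N) : Prop :=
  ∃ (r : TermIndex N n →₀ Loc N) (b : Fin N → TermIndex N n →₀ Loc N),
    r ∈ homogeneousTerms N n m ∧ (∀ q, r q ≠ 0 → q.1 j = 0) ∧
    (∀ i, b i ∈ homogeneousTerms N n m) ∧
    ∀ f, F f = evalTerms f r + ∑ i, totalDeriv i (evalTerms f (b i))

theorem ReducibleByParts.zero {N n : ℕ} (m : ℕ) (j : Fin n) :
    ReducibleByParts (N := N) m j fun _ => 0 :=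
  ⟨0, 0, zero_mem _, fun q h => absurd rfl h, fun _ => zero_mem _, fun f => by simp⟩

theorem ReducibleByParts.add {N n m : ℕ} {j : Fin n} {F G : (Fin n → Loc N) → Loc N}
    (hF : ReducibleByParts m j F) (hG : ReducibleByParts m j G) :
    ReducibleByParts m j fun f => F f + G f := by
  obtain ⟨r, b, hr, hj, hb, h⟩ := hF
  obtain ⟨r', b', hr', hj', hb', h'⟩ := hG
  refine ⟨r + r', b + b', add_mem hr hr', fun q hq => ?_, fun i => add_mem (hb i) (hb' i),
    fun f => ?_⟩
  · by_cases hq0 : r q = 0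
    · exact hj' q fun h0 => hq (by simp [hq0, h0])
    · exact hj q hq0
  · simp only [h, h', map_add, Pi.add_apply, Finset.sum_add_distrib]
    abel

theorem ReducibleByParts.neg {N n m : ℕ} {j : Fin n} {F : (Fin n → Loc N) → Loc N}
    (hF : ReducibleByParts m j F) : ReducibleByParts m j fun f => -F f := by
  obtain ⟨r, b, hr, hj, hb, h⟩ := hF
  refine ⟨(-1 : Loc N) • r, fun i => (-1 : Loc N) • b i, Submodule.smul_mem _ _ hr,
    fun q hq => hj q fun h0 => hq (by simp [h0]), fun i => Submodule.smul_mem _ _ (hb i),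
    fun f => ?_⟩
  have hneg : ∀ x : Loc N, (-1 : Loc N) * x = -x := fun x => by ring
  simp only [h, map_smul, smul_eq_mul, hneg, map_neg, Finset.sum_neg_distrib]
  abel

theorem ReducibleByParts.sum {N n m : ℕ} {j : Fin n} {ι : Type*} (s : Finset ι)
    {F : ι → (Fin n → Loc N) → Loc N} (hF : ∀ a ∈ s, ReducibleByParts m j (F a)) :
    ReducibleByParts m j fun f => ∑ a ∈ s, F a f := by
  classical
  induction s using Finset.induction_on with
  | empty => simpa using ReducibleByParts.zero m j
  | insert a s ha ih =>
    simp only [Finset.sum_insert ha]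
    exact (hF a (Finset.mem_insert_self a s)).add
      (ih fun b hb => hF b (Finset.mem_insert_of_mem hb))

theorem reducibleByParts_totalDeriv {N n : ℕ} (j : Fin n) (i : Fin N) (q : TermIndex N n)
    (c : Loc N) :
    ReducibleByParts (totalDegree q) j fun f => totalDeriv i (c * termValue q f) := by
  refine ⟨0, Pi.single i (Finsupp.single q c), zero_mem _, fun q h => absurd rfl h, fun i' => ?_,
    fun f => ?_⟩
  · by_cases h : i' = i
    · subst h
      rw [Pi.single_eq_same]
      exact Finsupp.single_mem_supported _ _ rfl
    · rw [Pi.single_eq_of_ne h]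
      exact zero_mem _
  · rw [map_zero, zero_add, Finset.sum_eq_single i]
    · rw [Pi.single_eq_same, evalTerms_single]
    · intro i' _ h
      rw [Pi.single_eq_of_ne h, map_zero, map_zero]
    · simp

/-- Induction on the number of total derivatives falling on argument `j`. The exponents of the
`∂/∂u_J` are never touched, so the formal degree is preserved. -/
theorem reducibleByParts_term {N n : ℕ} (j : Fin n) (q : TermIndex N n) (c : Loc N) :
    ReducibleByParts (totalDegree q) j fun f => c * termValue q f := by
  induction h : order (q.1 j) generalizing q c with
  | zero =>
    have h0 := order_eq_zero.1 h
    refine ⟨Finsupp.single q c, 0, Finsupp.single_mem_supported _ _ rfl, fun q' hq' => ?_,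
      fun _ => zero_mem _, fun f => by simp [evalTerms_single]⟩
    obtain rfl : q' = q := by
      by_contra hne
      exact hq' (Finsupp.single_eq_of_ne hne)
    exact h0
  | succ s ih =>
    obtain ⟨i, hi⟩ : ∃ i, q.1 j i ≠ 0 := by
      by_contra! h'
      rw [order_eq_zero.2 (funext h')] at h
      omega
    obtain ⟨q, rfl⟩ : ∃ q', raiseTerm i j q' = q := by
      refine ⟨(Function.update q.1 j (q.1 j - Pi.single i 1), q.2), Prod.ext ?_ rfl⟩
      simp [raiseTerm, raise_sub_single hi]
    have hs : order (q.1 j) = s := by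
      simpa [raiseTerm, order_raise] using h
    -- The Leibniz rule solved for the term in which `D_i` hits argument `j`; in the others it hits
    -- the coefficient or another argument.
    have hF : ∀ f, c * termValue (raiseTerm i j q) f = totalDeriv i (c * termValue q f) +
        -(totalDeriv i c * termValue q f +
          ∑ l ∈ Finset.univ.erase j, c * termValue (raiseTerm i l q) f) := by
      intro f
      rw [totalDeriv_mul, totalDeriv_termValue, ← Finset.add_sum_erase _ _ (Finset.mem_univ j),
        mul_add, Finset.mul_sum]
      ring
    simp only [hF]
    refine (reducibleByParts_totalDeriv j i q c).add ((ih q _ hs).add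
      (ReducibleByParts.sum _ fun l hl => ih (raiseTerm i l q) c ?_)).neg
    simpa [raiseTerm, Function.update_of_ne (Finset.ne_of_mem_erase hl).symm] using hs

theorem reducibleByParts_evalTerms {N n m : ℕ} (j : Fin n) {p : TermIndex N n →₀ Loc N}
    (hp : p ∈ homogeneousTerms N n m) : ReducibleByParts m j fun f => evalTerms f p := by
  simp only [evalTerms_eq_sum]
  refine ReducibleByParts.sum _ fun q hq => ?_
  obtain rfl : totalDegree q = m := (Finsupp.mem_supported _ _).1 hp hq
  exact reducibleByParts_term j q _

/-- Integration by parts: every operator is, up to total derivatives of operators, an operator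
which takes no total derivatives of its `j`-th argument. -/
theorem LDO.exists_integration_by_parts {N n : ℕ} (j : Fin n) (A : LDO N n) :
    ∃ (r : TermIndex N n → Loc N) (hr : FiniteInEachDegree r) (B : Fin N → LDO N n),
      (∀ q, r q ≠ 0 → q.1 j = 0) ∧ A = LDO.ofCoeff r hr + ∑ i, totalDerivLDO i (B i) := by
  classical
  obtain ⟨p, hp, hA⟩ := A.2
  -- The part of `p` of formal degree `m`, finite by hypothesis. Reducing each part within its own
  -- degree keeps the reassembled coefficients finite in each degree.
  let s : ℕ → TermIndex N n →₀ Loc N := fun m =>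
    Finsupp.onFinset (hp m).toFinset (fun q => if totalDegree q = m then p q else 0) fun q hq => by
      simp only [ne_eq, ite_eq_right_iff, not_forall] at hq
      exact (hp m).mem_toFinset.2 ⟨hq.1.le, hq.2⟩
  have hs : ∀ m, s m ∈ homogeneousTerms N n m := by
    refine fun m => (Finsupp.mem_supported _ _).2 fun q hq => ?_
    by_contra h
    exact Finsupp.mem_support_iff.1 hq (if_neg h)
  have hps : glueTerms s = p := funext fun q => if_pos rfl
  choose r b hr hj hb h using fun m => reducibleByParts_evalTerms j (hs m)
  refine ⟨glueTerms r, finiteInEachDegree_glueTerms r, fun i =>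
    LDO.ofCoeff (glueTerms fun m => b m i) (finiteInEachDegree_glueTerms _),
    fun q hq => hj _ q hq, ?_⟩
  refine Subtype.ext (MultilinearMap.ext fun f => ?_)
  choose k hk using fun j => exists_order (f j)
  have e : ((LDO.ofCoeff (glueTerms r) (finiteInEachDegree_glueTerms r) + ∑ i, totalDerivLDO i
      (LDO.ofCoeff (glueTerms fun m => b m i) (finiteInEachDegree_glueTerms _)) : LDO N n)).1 f =
      ∑ᶠ q, glueTerms r q * termValue q f +
        ∑ i, totalDeriv i (∑ᶠ q, glueTerms (fun m => b m i) q * termValue q f) := by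
    simp only [Submodule.coe_add, Submodule.coe_sum, add_apply,
      sum_apply]
    rfl
  rw [e, hA, ← hps, finsum_glueTerms hs hk, finsum_glueTerms hr hk]
  simp only [finsum_glueTerms (fun m => hb m _) hk, map_sum, h, Finset.sum_add_distrib]
  rw [Finset.sum_comm]

/-! ### Locality -/

theorem dirDeriv_apply_eq_zero {N : ℕ} {U : Set (InfJet N)} (hU : IsOpen U) {f : Loc N}
    (hf : ∀ p ∈ U, f.1 p = 0) (v : InfJet N) : ∀ p ∈ U, (dirDeriv v f).1 p = 0 := by
  intro p hp
  change lineDeriv ℝ f.1 p v = 0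
  have hc : Continuous fun t : ℝ => p + t • v := by fun_prop
  have : (fun t : ℝ => f.1 (p + t • v)) =ᶠ[nhds 0] fun _ => 0 := by
    filter_upwards [hc.continuousAt.preimage_mem_nhds (hU.mem_nhds (by simpa using hp))] with t ht
    exact hf _ ht
  rw [lineDeriv, this.deriv_eq, deriv_const]

theorem fibreDerivPow_apply_eq_zero {N : ℕ} {U : Set (InfJet N)} (hU : IsOpen U)
    (α : MultiIndex N →₀ ℕ) {f : Loc N} (hf : ∀ p ∈ U, f.1 p = 0) :
    ∀ p ∈ U, (fibreDerivPow α f).1 p = 0 := by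
  revert f
  refine Finset.noncommProd_induction _ _ _ (fun T : Module.End ℝ (Loc N) =>
    ∀ {f : Loc N}, (∀ p ∈ U, f.1 p = 0) → ∀ p ∈ U, (T f).1 p = 0) ?_ ?_ ?_
  · exact fun S T hS hT f hf => hS (hT hf)
  · exact fun hf => hf
  · intro J _
    induction α J with
    | zero => exact fun hf => hf
    | succ a ih =>
      intro f hf
      rw [pow_succ]
      exact ih (dirDeriv_apply_eq_zero hU hf _)

theorem fibreDerivPow_coordX_mul {N : ℕ} (α : MultiIndex N →₀ ℕ) (i : Fin N) (f : Loc N) :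
    fibreDerivPow α (coordX i * f) = coordX i * fibreDerivPow α f := by
  revert f
  refine Finset.noncommProd_induction _ _ _ (fun T : Module.End ℝ (Loc N) =>
    ∀ f : Loc N, T (coordX i * f) = coordX i * T f) ?_ ?_ ?_
  · intro S T hS hT f
    rw [Module.End.mul_apply, Module.End.mul_apply, hT, hS]
  · exact fun f => rfl
  · intro J _
    induction α J with
    | zero => exact fun f => rfl
    | succ a ih =>
      intro f
      rw [pow_succ, Module.End.mul_apply, Module.End.mul_apply, fibreDeriv_coordX_mul, ih]

theorem termValue_update {N n : ℕ} {j : Fin n} {q : TermIndex N n} (hq : q.1 j = 0) (f : Fin n → Loc N) (g : Loc N) :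
    termValue q (Function.update f j g) = fibreDerivPow (q.2 j) g *
      ∏ l ∈ Finset.univ.erase j, totalDerivPow (q.1 l) (fibreDerivPow (q.2 l) (f l)) := by
  rw [termValue, ← Finset.mul_prod_erase _ _ (Finset.mem_univ j), hq, totalDerivPow_zero,
    Function.update_self]
  congr 1
  refine Finset.prod_congr rfl fun l hl => ?_
  rw [Function.update_of_ne (Finset.ne_of_mem_erase hl)]

/-- Here the absence of total derivatives is essential: `∂/∂u_J` commutes with `x^i`, whereas `D_i`
does not. -/
theorem ofCoeff_update_coordX_mul {N n : ℕ} {j : Fin n} {r : TermIndex N n → Loc N}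
    (hr : FiniteInEachDegree r) (hj : ∀ q, r q ≠ 0 → q.1 j = 0) (f : Fin n → Loc N) (i : Fin N) (g : Loc N) :
    (LDO.ofCoeff r hr).1 (Function.update f j (coordX i * g)) =
      coordX i * (LDO.ofCoeff r hr).1 (Function.update f j g) := by
  rw [LDO.ofCoeff_apply, LDO.ofCoeff_apply, mul_finsum' _ _ (finite_support_mul hr _)]
  refine finsum_congr fun q => ?_
  by_cases h : r q = 0
  · simp [h]
  · rw [termValue_update (hj q h), termValue_update (hj q h), fibreDerivPow_coordX_mul]
    ring

theorem ofCoeff_update_apply_eq_zero {N n : ℕ} {j : Fin n} {r : TermIndex N n → Loc N}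
    (hr : FiniteInEachDegree r) (hj : ∀ q, r q ≠ 0 → q.1 j = 0)
    {U : Set (InfJet N)} (hU : IsOpen U) (f : Fin n → Loc N)
    {g : Loc N} (hg : ∀ p ∈ U, g.1 p = 0) {p : InfJet N} (hp : p ∈ U) :
    ((LDO.ofCoeff r hr).1 (Function.update f j g)).1 p = 0 := by
  rw [LDO.ofCoeff_apply]
  refine finsum_induction (fun F : Loc N => F.1 p = 0) rfl (fun F G hF hG => ?_) fun q => ?_
  · change F.1 p + G.1 p = 0
    rw [hF, hG, add_zero]
  · by_cases h : r q = 0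
    · rw [h, zero_mul]
      rfl
    · rw [termValue_update (hj q h)]
      change _ * ((fibreDerivPow (q.2 j) g).1 p * _) = 0
      rw [fibreDerivPow_apply_eq_zero hU _ hg p hp, zero_mul, mul_zero]

/-! ### Operators whose values are divergences -/

theorem apply_eq_of_fibreDeriv_eq_zero {N : ℕ} {f : Loc N} {J : MultiIndex N}
    (hf : fibreDeriv J f = 0) (p : InfJet N) (t : ℝ) : f.1 (p + t • fibreDir J) = f.1 p := by
  obtain ⟨f, k, g, hg, rfl⟩ := f
  have hd : ∀ s : ℝ, HasDerivAt (fun s : ℝ => g (jetProj N k (p + s • fibreDir J))) 0 s := by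
    intro s
    have h0 : fderiv ℝ g (jetProj N k (p + s • fibreDir J)) (jetProj N k (fibreDir J)) = 0 := by
      rw [← lineDeriv_comp_jetProj hg]
      exact congrFun (congrArg Subtype.val hf) (p + s • fibreDir J)
    have h1 : HasDerivAt (fun s : ℝ => jetProj N k p + s • jetProj N k (fibreDir J))
        (jetProj N k (fibreDir J)) s := by
      simpa using ((hasDerivAt_id s).smul_const (jetProj N k (fibreDir J))).const_add
        (jetProj N k p)
    have h2 := (hg.differentiable (by simp)
      (jetProj N k p + s • jetProj N k (fibreDir J))).hasFDerivAt.comp_hasDerivAt s h1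
    simp only [map_add, map_smul] at h0 ⊢
    rw [h0] at h2
    exact h2
  have := is_const_of_deriv_eq_zero (fun s => (hd s).differentiableAt) (fun s => (hd s).deriv) t 0
  simpa using this

/-- A local function which is `1` where `u_J` is close to `a` and `0` where it is close to
`a + 3`. -/
theorem exists_cutoff {N : ℕ} (J : MultiIndex N) (a : ℝ) : ∃ χ : Loc N,
    (∀ p : InfJet N, p.2 J < a + 1 → χ.1 p = 1) ∧ ∀ p : InfJet N, a + 2 < p.2 J → χ.1 p = 0 := by
  refine ⟨⟨fun p => Real.smoothTransition (a + 2 - p.2 J), order J,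
    fun q => Real.smoothTransition (a + 2 - q.2 ⟨J, mem_multiIndicesLE.2 le_rfl⟩), ?_, rfl⟩, ?_, ?_⟩
  · exact Real.smoothTransition.contDiff.comp (contDiff_const.sub
      ((contDiff_apply ℝ ℝ _).comp contDiff_snd))
  · exact fun p hp => Real.smoothTransition.one_of_one_le (by linarith)
  · exact fun p hp => Real.smoothTransition.zero_of_nonpos (by linarith)

/-- An operator which takes no total derivatives of its `j`-th argument and all of whose values are
divergences vanishes. -/
theorem ofCoeff_eq_zero_of_divergences {N n : ℕ} {j : Fin n} {r : TermIndex N n → Loc N}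
    (hr : FiniteInEachDegree r) (hj : ∀ q, r q ≠ 0 → q.1 j = 0)
    (hdiv : ∀ f, ∃ b : Fin N → Loc N, (LDO.ofCoeff r hr).1 f = ∑ i, totalDeriv i (b i)) :
    LDO.ofCoeff r hr = 0 := by
  refine Subtype.ext (MultilinearMap.ext fun f => Subtype.ext (funext fun p => ?_))
  set G : Loc N → Loc N := fun g => (LDO.ofCoeff r hr).1 (Function.update f j g) with hG
  have hfib : ∀ g, fibreDeriv 0 (G g) = 0 := fun g =>
    fibreDeriv_eq_zero_of_divergences (S := Set.range G)
      (by
        rintro i _ ⟨g, rfl⟩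
        exact ⟨coordX i * g, ofCoeff_update_coordX_mul hr hj f i g⟩)
      (by
        rintro _ ⟨g, rfl⟩
        exact hdiv _)
      ⟨g, rfl⟩ 0
  obtain ⟨χ, h1, h0⟩ := exists_cutoff (0 : MultiIndex N) (p.2 0)
  have hc : Continuous fun p : InfJet N => p.2 0 := by fun_prop
  -- The two arguments agree on the open set `u_0 < p.2 0 + 1` around `p`.
  have e1 : (G (f j)).1 p = (G (χ * f j)).1 p := by
    have hz : (G (f j - χ * f j)).1 p = 0 := by
      refine ofCoeff_update_apply_eq_zero hr hj (isOpen_lt hc (continuous_const (y := p.2 0 + 1)))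
        f (fun p' hp' => ?_) (show p.2 0 < p.2 0 + 1 by linarith)
      change (f j).1 p' - χ.1 p' * (f j).1 p' = 0
      rw [h1 p' hp']
      ring
    have hsub : G (f j - χ * f j) = G (f j) - G (χ * f j) := MultilinearMap.map_update_sub _ _ _ _ _
    rw [hsub] at hz
    exact sub_eq_zero.1 hz
  -- A shift by `3` lands where `u_0 > p.2 0 + 2`, and there the cutoff argument vanishes.
  have e2 : (G (χ * f j)).1 (p + (3 : ℝ) • fibreDir 0) = 0 := by
    refine ofCoeff_update_apply_eq_zero hr hj (isOpen_lt (continuous_const (y := p.2 0 + 2)) hc)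
      f (fun p' hp' => ?_) ?_
    · change χ.1 p' * _ = 0
      rw [h0 p' hp', zero_mul]
    · change p.2 0 + 2 < (p + (3 : ℝ) • fibreDir 0).2 0
      simp [fibreDir]
      norm_num
  rw [apply_eq_of_fibreDeriv_eq_zero (hfib _), ← e1] at e2
  simp only [hG, Function.update_eq_self] at e2
  exact e2

/-- An operator all of whose values are divergences is a sum of total derivatives. -/
theorem LDO.exists_eq_sum_totalDerivLDO {N n : ℕ} (A : LDO N n)
    (hdiv : ∀ f, ∃ b : Fin N → Loc N, A.1 f = ∑ i, totalDeriv i (b i)) :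
    ∃ B : Fin N → LDO N n, A = ∑ i, totalDerivLDO i (B i) := by
  have happ : ∀ (B : Fin N → LDO N n) f,
      (∑ i, totalDerivLDO i (B i)).1 f = ∑ i, totalDeriv i ((B i).1 f) := by
    intro B f
    simp only [Submodule.coe_sum, sum_apply]
    rfl
  cases n with
  -- There is no argument to free from derivatives, but also only one term index, so the given `b i`
  -- serve directly as coefficients.
  | zero =>
    obtain ⟨b, hb⟩ := hdiv Fin.elim0
    have hfin : ∀ c : Loc N, FiniteInEachDegree fun _ : TermIndex N 0 => c :=
      fun c m => Set.toFinite _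
    refine ⟨fun i => LDO.ofCoeff (fun _ => b i) (hfin _), ?_⟩
    refine Subtype.ext (MultilinearMap.ext fun f => ?_)
    rw [happ, Subsingleton.elim f Fin.elim0, hb]
    refine Finset.sum_congr rfl fun i _ => ?_
    rw [LDO.ofCoeff_apply, finsum_eq_single _ (Fin.elim0, Fin.elim0) fun q hq => absurd (Subsingleton.elim _ _) hq]
    simp [termValue]
  | succ n =>
    obtain ⟨r, hr, B, hj, hA⟩ := LDO.exists_integration_by_parts 0 A
    refine ⟨B, ?_⟩
    rw [hA, ofCoeff_eq_zero_of_divergences hr hj, zero_add]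
    intro f
    obtain ⟨b, hb⟩ := hdiv f
    -- The remainder differs from `A` by a divergence, so its values are still divergences.
    refine ⟨fun i => b i - (B i).1 f, ?_⟩
    rw [hA] at hb
    change (LDO.ofCoeff r hr).1 f + (∑ i, totalDerivLDO i (B i)).1 f = _ at hb
    rw [happ] at hb
    simp only [map_sub, Finset.sum_sub_distrib, ← hb, add_sub_cancel_right]

/-! ### Top degree forms -/

/-- A form of degree `N - 1` has one coefficient for each omitted index, so its coefficients are an
arbitrary family `b`, up to signs that can be absorbed. -/
theorem mem_range_formDiff_top {N k : ℕ} {V : Type*} [AddCommMonoid V] [Module ℝ V]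
    (D : Fin N → V →ₗ[ℝ] V) (h : k + 1 = N) (θ : HForm N N V) :
    θ ∈ LinearMap.range (formDiff D h) ↔
      ∃ b : Fin N → V, θ ⟨Finset.univ, Finset.card_fin N⟩ = ∑ i, D i (b i) := by
  have hsub : ∀ s : {s : Finset (Fin N) // s.card = N}, s = ⟨Finset.univ, Finset.card_fin N⟩ :=
    fun s => Subtype.ext ((Finset.card_eq_iff_eq_univ _).1 (by simp [s.2]))
  have hval : ∀ η : HForm N k V, formDiff D h η ⟨Finset.univ, Finset.card_fin N⟩ =
      ∑ i, D i ((-1 : ℝ) ^ (Finset.univ.filter (· < i)).card • η ⟨Finset.univ.erase i, by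
        rw [Finset.card_erase_of_mem (Finset.mem_univ i), Finset.card_fin]; omega⟩) := by
    intro η
    simp only [formDiff, LinearMap.coe_mk, AddHom.coe_mk, map_smul]
    exact Fintype.sum_equiv (Equiv.subtypeUnivEquiv fun i => Finset.mem_univ i) _ _ fun i => rfl
  constructor
  · rintro ⟨η, rfl⟩
    exact ⟨_, hval η⟩
  · rintro ⟨b, hb⟩
    have hex : ∀ s : {s : Finset (Fin N) // s.card = k}, ∃ i, s.1 = Finset.univ.erase i := by
      intro s
      obtain ⟨i, hi⟩ := Finset.card_eq_one.1 (show s.1ᶜ.card = 1 by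
        rw [Finset.card_compl, s.2, Fintype.card_fin]; omega)
      exact ⟨i, by rw [← compl_compl s.1, hi, Finset.compl_singleton]⟩
    choose e he using hex
    -- `e s` is the index missing from `s`; the sign put in here squares to one against the sign in
    -- `formDiff`.
    refine ⟨fun s => (-1 : ℝ) ^ (Finset.univ.filter (· < e s)).card • b (e s), ?_⟩
    funext s
    rw [hsub s, hval, hb]
    refine Finset.sum_congr rfl fun i _ => ?_
    have hi : ∀ hc, e ⟨Finset.univ.erase i, hc⟩ = i := by
      intro hc
      have := congrArg compl (he ⟨Finset.univ.erase i, hc⟩)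
      rw [Finset.compl_erase, Finset.compl_erase] at this
      simpa using this.symm
    rw [hi, smul_smul, ← mul_pow]
    simp

end JetCalculus

end

theorem corollary6p6 (N n : ℕ) (hN : 1 ≤ N) (A : JetCalculus.OperatorForm N n N) :
    (∀ f : Fin n → JetCalculus.Loc N, JetCalculus.OperatorForm.value A f ∈
        LinearMap.range (JetCalculus.dH (N := N) (k := N - 1) (l := N) (Nat.sub_add_cancel hN))) ↔
      A ∈ LinearMap.range
        (JetCalculus.operatorDiff (N := N) (n := n) (k := N - 1) (l := N)
          (Nat.sub_add_cancel hN)) := by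
  simp only [JetCalculus.dH, JetCalculus.operatorDiff, JetCalculus.mem_range_formDiff_top]
  constructor
  · exact JetCalculus.LDO.exists_eq_sum_totalDerivLDO _
  · rintro ⟨B, hB⟩ f
    refine ⟨fun i => (B i).1 f, ?_⟩
    rw [JetCalculus.OperatorForm.value, hB]
    simp only [Submodule.coe_sum, sum_apply]
    rfl
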